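/- Let $R$ be a commutative Artinian ring and let $\Lambda$ be an Artin $R$-algebra, that is, an (associative, unital) $R$-algebra which is finitely generated as an $R$-module. Assume that $\Lambda$ is basic, connected and not semisimple, and that its Jacobson radical $r$ satisfies $r^2=0$. Here basic means that $\Lambda$ has a finite complete set of primitive orthogonal idempotents $e_1,\dots,e_n$ whose left modules $\Lambda e_i$ are pairwise non-isomorphic, and connected means that $\Lambda$ is nonzero and is not a direct product of two nonzero algebras. All modules are finitely generated left $\Lambda$-modules. A morphism $h:B\to C$ is called right almost split if it is not a split epimorphism and every morphism $m:N\to C$ that is not a split epimorphism is of the form $m=ht$ with $t:N\to B$. Dually, a morphism $g:A\to B$ is called left almost split if it is not a split monomorphism and every morphism $m:A\to N$ that is not a split monomorphism is of the form $m=tg$ with $t:B\to N$. An exact sequence $0\to A\xrightarrow{g}B\xrightarrow{h}C\to 0$ is called almost split if $g$ is left almost split and $h$ is right almost split. **Proposition 3.2.** The following are equivalent: 1. $\Lambda$ is self-injective (that is, $\Lambda$ is injective as a left $\Lambda$-module) and local; 2. there is an almost split sequence $0\to S\to P\to S\to 0$ with $S$ a simple $\Lambda$-module; 3. there is an almost split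 sequence $0\to S\to P\to S\to 0$ with $S$ a simple $\Lambda$-module and $P$ a projective $\Lambda$-module. -/

import Mathlib

universe u v

/-- An idempotent `e` is primitive if `e ≠ 0` and `e` is not a sum of two nonzero orthogonal
idempotents. -/
def IsPrimitiveIdempotent {Λ : Type*} [Ring Λ] (e : Λ) : Prop :=
  IsIdempotentElem e ∧ e ≠ 0 ∧
    ∀ a b : Λ, IsIdempotentElem a → IsIdempotentElem b → a * b = 0 → b * a = 0 →
      e = a + b → a = 0 ∨ b = 0

/-- A ring is basic if it has a finite complete set `e₁, …, eₙ` of primitive orthogonal idempotents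
such that the indecomposable projective left modules `Λeᵢ` are pairwise non-isomorphic. -/
def IsBasicRing (Λ : Type*) [Ring Λ] : Prop :=
  ∃ (n : ℕ) (e : Fin n → Λ), CompleteOrthogonalIdempotents e ∧
    (∀ i, IsPrimitiveIdempotent (e i)) ∧
    ∀ i j, i ≠ j → IsEmpty ((Ideal.span {e i} : Ideal Λ) ≃ₗ[Λ] (Ideal.span {e j} : Ideal Λ))

/-- A ring is connected if it is nonzero and is not a direct product of two nonzero rings, i.e. its
only central idempotents are `0` and `1`. -/
def IsConnectedRing (Λ : Type*) [Ring Λ] : Prop :=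
  Nontrivial Λ ∧ ∀ e ∈ Subring.center Λ, IsIdempotentElem e → e = 0 ∨ e = 1

/-- A split epimorphism of modules. -/
def IsSplitEpimorphism {Λ : Type*} [Ring Λ] {M N : Type*} [AddCommGroup M] [Module Λ M]
    [AddCommGroup N] [Module Λ N] (h : M →ₗ[Λ] N) : Prop :=
  ∃ s : N →ₗ[Λ] M, h ∘ₗ s = LinearMap.id

/-- A split monomorphism of modules. -/
def IsSplitMonomorphism {Λ : Type*} [Ring Λ] {M N : Type*} [AddCommGroup M] [Module Λ M]
    [AddCommGroup N] [Module Λ N] (g : M →ₗ[Λ] N) : Prop :=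
  ∃ t : N →ₗ[Λ] M, t ∘ₗ g = LinearMap.id

/-- A morphism `h : B → C` is right almost split (in the category of finitely generated left
modules) if it is not a split epimorphism and every morphism `N → C` from a finitely generated
module that is not a split epimorphism factors through `h`. Every finitely generated module is
isomorphic to one in the universe of `Λ`, so it suffices to let `N` range over that universe. -/
def IsRightAlmostSplit {Λ : Type u} [Ring Λ] {B C : Type v} [AddCommGroup B] [Module Λ B]
    [AddCommGroup C] [Module Λ C] (h : B →ₗ[Λ] C) : Prop :=
  ¬ IsSplitEpimorphism h ∧
    ∀ (N : Type u) [AddCommGroup N] [Module Λ N] [Module.Finite Λ N] (m : N →ₗ[Λ] C),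
      ¬ IsSplitEpimorphism m → ∃ t : N →ₗ[Λ] B, m = h ∘ₗ t

/-- A morphism `g : A → B` is left almost split (in the category of finitely generated left
modules) if it is not a split monomorphism and every morphism `A → N` to a finitely generated
module that is not a split monomorphism factors through `g`. -/
def IsLeftAlmostSplit {Λ : Type u} [Ring Λ] {A B : Type v} [AddCommGroup A] [Module Λ A]
    [AddCommGroup B] [Module Λ B] (g : A →ₗ[Λ] B) : Prop :=
  ¬ IsSplitMonomorphism g ∧
    ∀ (N : Type u) [AddCommGroup N] [Module Λ N] [Module.Finite Λ N] (m : A →ₗ[Λ] N),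
      ¬ IsSplitMonomorphism m → ∃ t : B →ₗ[Λ] N, m = t ∘ₗ g

/-- The sequence `0 → A → B → C → 0` given by `g : A → B` and `h : B → C` is an almost split
sequence of finitely generated modules: it is exact, `g` is left almost split and `h` is right
almost split. -/
structure IsAlmostSplitSequence {Λ : Type u} [Ring Λ] {A B C : Type v}
    [AddCommGroup A] [Module Λ A] [AddCommGroup B] [Module Λ B] [AddCommGroup C] [Module Λ C]
    (g : A →ₗ[Λ] B) (h : B →ₗ[Λ] C) : Prop where
  finite_left : Module.Finite Λ A
  finite_middle : Module.Finite Λ B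
  finite_right : Module.Finite Λ C
  injective : Function.Injective g
  exact : Function.Exact g h
  surjective : Function.Surjective h
  left_almost_split : IsLeftAlmostSplit g
  right_almost_split : IsRightAlmostSplit h

/-! ### Idempotents and simple modules when the radical squares to zero. -/

section SquareZero

variable {Λ : Type u} [Ring Λ]

/-! (2 ⇒ 1) Take a primitive idempotent `e` with `eS ≠ 0` and a lift `p = ep` in `P` of a nonzero
element of `S`. Right almost splitness makes `Λe → P`, `x ↦ xp`, injective
(`IsAlmostSplitSequence.eq_zero_of_smul_eq_zero`). Some `y ∈ re` maps to a generator of the image of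
`S`, and left almost splitness puts every radical element of `eΛ` in `yΛ`
(`IsAlmostSplitSequence.exists_eq_mul`). As `P` has only `S` as composition factor and `Λ` is basic,
`fΛe` and `eΛf` vanish for the other idempotents `f`. So `e` is central, and connectedness gives `e
= 1`. Then `Λ` is local with `0`, `r = Λy`, `Λ` as its only left ideals, and Baer's criterion
reduces to maps out of `r`.

(1 ⇒ 3) For `0 ≠ a ∈ r`, self-injectivity gives `r = aΛ`, and finite length over `R` upgrades this
to `r = Λa`. Right multiplication by `a` then yields `0 → Λ/r → Λ → Λ/r → 0`. Injectivity of `Λ`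
provides the lifts on the right, semisimplicity of `N/aN` the extensions on the left. -/

lemma smul_eq_zero_of_mem_jacobson {S : Type*} [AddCommGroup S] [Module Λ S]
    [IsSemisimpleModule Λ S] {x : Λ} (hx : x ∈ Ring.jacobson Λ) (s : S) : x • s = 0 :=
  Module.mem_annihilator.mp (IsSemisimpleModule.jacobson_le_annihilator Λ S hx) s

lemma mul_eq_zero_of_jacobson_sq (hr : Ring.jacobson Λ ^ 2 = ⊥) {x y : Λ}
    (hx : x ∈ Ring.jacobson Λ) (hy : y ∈ Ring.jacobson Λ) : x * y = 0 := by
  have : x * y ∈ Ring.jacobson Λ ^ 2 := by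
    rw [(Ring.jacobson Λ).pow_succ, (Ring.jacobson Λ).pow_one]
    exact Submodule.smul_mem_smul hx hy
  rwa [hr] at this

/-- In an Artinian ring with square-zero radical, a left ideal not contained in the radical
contains a nonzero idempotent. -/
lemma exists_isIdempotentElem_mul [IsArtinianRing Λ] (hr : Ring.jacobson Λ ^ 2 = ⊥) {x : Λ}
    (hx : x ∉ Ring.jacobson Λ) : ∃ c, IsIdempotentElem (c * x) ∧ c * x ≠ 0 := by
  let π := Ideal.Quotient.mk (Ring.jacobson Λ)
  obtain ⟨f, hf, hspan⟩ := IsSemisimpleRing.ideal_eq_span_idempotent (Ideal.span {π x})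
  have hfx : f ∈ Ideal.span {π x} := by rw [hspan]; exact Ideal.mem_span_singleton_self f
  obtain ⟨a, ha⟩ := Ideal.mem_span_singleton'.mp hfx
  obtain ⟨a, rfl⟩ := Ideal.Quotient.mk_surjective a
  have hπx : π x ≠ 0 := fun h => hx (Ideal.Quotient.eq_zero_iff_mem.mp h)
  have hf0 : f ≠ 0 := by
    rintro rfl
    apply hπx
    have : π x ∈ Ideal.span {(0 : Λ ⧸ Ring.jacobson Λ)} := by
      rw [← hspan]; exact Ideal.mem_span_singleton_self _
    simpa using this
  obtain ⟨n, hn⟩ : ∃ n, n = a * x := ⟨_, rfl⟩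
  have hπn : π n = f := by rw [← ha, hn, map_mul]
  have hd : n * n - n ∈ Ring.jacobson Λ := by
    apply Ideal.Quotient.eq_zero_iff_mem.mp
    change π (n * n - n) = 0
    rw [map_sub, map_mul, hπn, hf.eq, sub_self]
  have hdd := mul_eq_zero_of_jacobson_sq hr hd hd
  -- Idempotent lifting: `3n² - 2n³` agrees with `n` modulo `r` and is idempotent modulo `(n² - n)²
  -- = 0`.
  have hc : (3 * n - 2 * (n * n)) * a * x = 3 * n * n - 2 * n * n * n := by
    rw [mul_assoc, ← hn]; noncomm_ring
  refine ⟨(3 * n - 2 * (n * n)) * a, ?_, ?_⟩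
  · rw [hc, IsIdempotentElem, ← sub_eq_zero]
    calc _ = (n * n - n) * (n * n - n) * (4 * n * n - 4 * n - 3) := by noncomm_ring
      _ = 0 := by rw [hdd, zero_mul]
  · intro h0
    apply hf0
    have := congrArg π (hc.symm.trans h0)
    simp only [map_sub, map_mul, hπn, map_zero, mul_assoc, hf.eq, map_ofNat] at this
    rw [← sub_mul] at this
    norm_num at this
    exact this

/-- If `e` is primitive, every element of `Λe` outside the radical generates `Λe`. -/
lemma IsPrimitiveIdempotent.exists_mul_eq [IsArtinianRing Λ]
    (hr : Ring.jacobson Λ ^ 2 = ⊥) {e x : Λ}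
    (he : IsPrimitiveIdempotent e) (hxe : x * e = x) (hx : x ∉ Ring.jacobson Λ) :
    ∃ c, c * x = e := by
  obtain ⟨he, -, hprim⟩ := he
  obtain ⟨c, hf, hf0⟩ := exists_isIdempotentElem_mul hr hx
  obtain ⟨f, hfd⟩ : ∃ f, f = c * x := ⟨_, rfl⟩
  rw [← hfd] at hf hf0
  have hfe : f * e = f := by rw [hfd, mul_assoc, hxe]
  -- `f` is only in `Λe`; `e * f` is an idempotent of `eΛe`, to which primitivity applies.
  have h1 : e * f * (e * f) = e * f := by
    rw [mul_assoc, ← mul_assoc f, hfe, hf.eq]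
  have h2 : e * f * e = e * f := by rw [mul_assoc, hfe]
  have h3 : e * (e * f) = e * f := by rw [← mul_assoc, he.eq]
  rcases hprim (e * f) (e - e * f) h1
    (by rw [IsIdempotentElem, sub_mul, mul_sub, mul_sub, he.eq, h1, h2, h3]; simp)
    (by rw [mul_sub, h1, h2, sub_self]) (by rw [sub_mul, h1, h3, sub_self]) (by simp) with h | h
  · refine (hf0 ?_).elim
    rw [← hf.eq]
    nth_rw 1 [← hfe]
    rw [mul_assoc, h, mul_zero]
  · exact ⟨e * c, by rw [mul_assoc, ← hfd]; exact (sub_eq_zero.mp h).symm⟩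

/-- Elements `a ∈ eΛe'` and `b ∈ e'Λe` with `a * b = e` give an isomorphism `Λe ≃ Λe'` when `e'` is
primitive. -/
lemma nonempty_span_equiv_of_mul_eq {e e' a b : Λ} (he : IsIdempotentElem e) (he0 : e ≠ 0)
    (he' : IsPrimitiveIdempotent e') (hae : e * a = a) (hae' : a * e' = a)
    (hbe' : e' * b = b) (hbe : b * e = b) (hab : a * b = e) :
    Nonempty ((Ideal.span {e} : Ideal Λ) ≃ₗ[Λ] (Ideal.span {e'} : Ideal Λ)) := by
  have hba : b * a = e' := by
    have h1 : b * a * (b * a) = b * a := by rw [mul_assoc, ← mul_assoc a, hab, hae]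
    have h2 : b * a * e' = b * a := by rw [mul_assoc, hae']
    have h3 : e' * (b * a) = b * a := by rw [← mul_assoc, hbe']
    have h4 := he'.1.eq
    rcases he'.2.2 (b * a) (e' - b * a) h1
      (by rw [IsIdempotentElem, sub_mul, mul_sub, mul_sub, h4, h1, h2, h3]; simp)
      (by rw [mul_sub, h1, h2, sub_self]) (by rw [sub_mul, h1, h3, sub_self]) (by simp) with h | h
    · refine (he0 ?_).elim
      rw [← he.eq]
      nth_rw 1 [← hab]
      rw [← hab, mul_assoc, ← mul_assoc b, h, zero_mul, mul_zero]
    · exact (sub_eq_zero.mp h).symm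
  have key {i a' : Λ} (x : (Ideal.span {i} : Ideal Λ)) (h : i * a' = a') {j : Λ}
      (h' : a' * j = a') : LinearMap.toSpanSingleton Λ Λ a' x ∈ Ideal.span {j} :=
    Ideal.mem_span_singleton'.mpr ⟨x * a', by simp [mul_assoc, h']⟩
  have mem {i : Λ} (hi : i * i = i) (x : (Ideal.span {i} : Ideal Λ)) : (x : Λ) * i = x := by
    obtain ⟨y, hy⟩ := Ideal.mem_span_singleton'.mp x.2
    rw [← hy, mul_assoc, hi]
  refine ⟨LinearEquiv.ofLinearMap
    (((LinearMap.toSpanSingleton Λ Λ a).comp (Submodule.subtype _)).codRestrict _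
      fun x => key x hae hae')
    (((LinearMap.toSpanSingleton Λ Λ b).comp (Submodule.subtype _)).codRestrict _
      fun x => key x hbe' hbe) ?_ ?_⟩
  · exact LinearMap.ext fun x => Subtype.ext <|
      show (x : Λ) * b * a = x by rw [mul_assoc, hba, mem he'.1]
  · exact LinearMap.ext fun x => Subtype.ext <|
      show (x : Λ) * a * b = x by rw [mul_assoc, hab, mem he]

/-- Variant of `nonempty_span_equiv_of_mul_eq` with a generator of `Λe'` in `eΛe'`. -/
lemma nonempty_span_equiv_of_notMem [IsArtinianRing Λ] (hr : Ring.jacobson Λ ^ 2 = ⊥) {e e' x : Λ}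
    (he : IsPrimitiveIdempotent e) (he' : IsPrimitiveIdempotent e') (hxe : e * x = x)
    (hxe' : x * e' = x) (hx : x ∉ Ring.jacobson Λ) :
    Nonempty ((Ideal.span {e} : Ideal Λ) ≃ₗ[Λ] (Ideal.span {e'} : Ideal Λ)) := by
  obtain ⟨c, hc⟩ := he'.exists_mul_eq hr hxe' hx
  obtain ⟨φ⟩ := nonempty_span_equiv_of_mul_eq (a := e' * c * e) (b := x) he'.1 he'.2.1 he
    (by rw [← mul_assoc, ← mul_assoc, he'.1.eq]) (by rw [mul_assoc, he.1.eq]) hxe hxe'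
    (by rw [mul_assoc, hxe, mul_assoc, hc, he'.1.eq])
  exact ⟨φ.symm⟩

/-- Primitive idempotents acting nontrivially on the same simple module are equivalent. -/
lemma nonempty_span_equiv_of_smul_ne_zero [IsArtinianRing Λ]
    (hr : Ring.jacobson Λ ^ 2 = ⊥) {e e' : Λ}
    {S : Type*} [AddCommGroup S] [Module Λ S] [IsSimpleModule Λ S]
    (he : IsPrimitiveIdempotent e) (he' : IsPrimitiveIdempotent e')
    {s s' : S} (hs : e • s ≠ 0) (hs' : e' • s' ≠ 0) :
    Nonempty ((Ideal.span {e} : Ideal Λ) ≃ₗ[Λ] (Ideal.span {e'} : Ideal Λ)) := by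
  obtain ⟨l, hl⟩ := IsSimpleModule.toSpanSingleton_surjective Λ hs' (e • s)
  have hl : l • e' • s' = e • s := hl
  refine nonempty_span_equiv_of_notMem hr (x := e * l * e') he he'
    (by rw [← mul_assoc, ← mul_assoc, he.1.eq]) (by rw [mul_assoc, he'.1.eq]) fun h => ?_
  have := smul_eq_zero_of_mem_jacobson h s'
  rw [mul_smul, mul_smul, hl, ← mul_smul, he.1.eq] at this
  exact hs this

/-- Over an Artinian ring, a module annihilated by the radical is semisimple. -/
lemma isSemisimpleModule_of_jacobson_smul_eq_zero [IsArtinianRing Λ] {M : Type*} [AddCommGroup M]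
    [Module Λ M] (hM : ∀ a ∈ Ring.jacobson Λ, ∀ x : M, a • x = 0) : IsSemisimpleModule Λ M := by
  have h : Module.IsTorsionBySet Λ M (Ring.jacobson Λ : Set Λ) := fun x a => hM a a.2 x
  let _ := h.module
  exact h.isSemisimpleModule_iff.mp inferInstance

/-- Since `r² = 0`, `r` is a semisimple left module, so `Λx` has a complement `C` in it. -/
lemma exists_compl_span_singleton [IsArtinianRing Λ] (hr : Ring.jacobson Λ ^ 2 = ⊥) {x : Λ}
    (hx : x ∈ Ring.jacobson Λ) (hx0 : x ≠ 0) : ∃ C : Ideal Λ, C ≤ Ring.jacobson Λ ∧ x ∉ C ∧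
      ∀ y ∈ Ring.jacobson Λ, ∃ l, y - l * x ∈ C := by
  have : IsSemisimpleModule Λ (Ring.jacobson Λ) :=
    isSemisimpleModule_of_jacobson_smul_eq_zero fun a ha y =>
      Subtype.ext (mul_eq_zero_of_jacobson_sq hr ha y.2)
  obtain ⟨C, hC⟩ := exists_isCompl (Submodule.span Λ {(⟨x, hx⟩ : Ring.jacobson Λ)})
  refine ⟨C.map (Submodule.subtype _), Submodule.map_subtype_le _ _, ?_, fun y hy => ?_⟩
  · rintro ⟨z, hz, rfl⟩
    have := Submodule.disjoint_def.mp hC.disjoint z (Submodule.mem_span_singleton_self _) hz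
    exact hx0 (by simp [this])
  · have : (⟨y, hy⟩ : Ring.jacobson Λ) ∈ Submodule.span Λ {(⟨x, hx⟩ : Ring.jacobson Λ)} ⊔ C := by
      rw [hC.sup_eq_top]; trivial
    obtain ⟨u, hu, c, hc, huc⟩ := Submodule.mem_sup.mp this
    obtain ⟨l, rfl⟩ := Submodule.mem_span_singleton.mp hu
    refine ⟨l, c, hc, ?_⟩
    have := congrArg Subtype.val huc
    simp only [Submodule.coe_add, Submodule.coe_smul, smul_eq_mul] at this
    simp [← this]

end SquareZero

/-! ### From an almost split sequence to a self-injective local ring. -/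

section AlmostSplit

variable {Λ : Type u} [Ring Λ]

/-- A linear map out of a simple module sending a nonzero element `s` to `q`. -/
lemma exists_linearMap_of_annihilates {S N : Type*} [AddCommGroup S] [Module Λ S]
    [IsSimpleModule Λ S] [AddCommGroup N] [Module Λ N] {s : S} (hs : s ≠ 0) (q : N)
    (h : ∀ l : Λ, l • s = 0 → l • q = 0) : ∃ f : S →ₗ[Λ] N, f s = q := by
  have hsurj := IsSimpleModule.toSpanSingleton_surjective Λ hs
  let φ := (LinearMap.toSpanSingleton Λ S s).quotKerEquivOfSurjective hsurj
  let ψ := (LinearMap.ker (LinearMap.toSpanSingleton Λ S s)).liftQ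
    (LinearMap.toSpanSingleton Λ N q) fun l hl => h l hl
  refine ⟨ψ ∘ₗ φ.symm.toLinearMap, ?_⟩
  have : φ.symm s = Submodule.Quotient.mk 1 := by
    rw [LinearEquiv.symm_apply_eq]
    change s = (1 : Λ) • s
    rw [one_smul]
  change ψ (φ.symm s) = q
  rw [this]
  change (1 : Λ) • q = q
  rw [one_smul]

lemma isSplitEpimorphism_of_map_eq {S N : Type*} [AddCommGroup S] [Module Λ S]
    [IsSimpleModule Λ S] [AddCommGroup N] [Module Λ N] {s : S} (hs : s ≠ 0) {h : N →ₗ[Λ] S}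
    (f : S →ₗ[Λ] N) (hf : h (f s) = s) : IsSplitEpimorphism h := by
  refine ⟨f, LinearMap.ext fun y => ?_⟩
  obtain ⟨l, rfl⟩ := IsSimpleModule.toSpanSingleton_surjective Λ hs y
  simp [hf]

variable {S P : Type u} [AddCommGroup S] [Module Λ S]
  [AddCommGroup P] [Module Λ P] [IsSimpleModule Λ S]

/-- If the sequence `0 → S → P → S → 0` is almost split, any lift of a nonzero element of `S`
generates the image of `S` in `P`. -/
lemma IsAlmostSplitSequence.exists_smul_eq {g : S →ₗ[Λ] P} {h : P →ₗ[Λ] S}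
    (H : IsAlmostSplitSequence g h) {p : P} (hs : h p ≠ 0) (s : S) : ∃ l : Λ, l • p = g s := by
  -- Otherwise `h p ↦ p` would be a well-defined section of `h`.
  obtain ⟨l₀, h₀, h₁⟩ : ∃ l : Λ, l • h p = 0 ∧ l • p ≠ 0 := by
    by_contra! hcon
    obtain ⟨f, hf⟩ := exists_linearMap_of_annihilates hs p hcon
    exact H.right_almost_split.1 (isSplitEpimorphism_of_map_eq hs f (by rw [hf]))
  obtain ⟨s', hs'⟩ := (H.exact (l₀ • p)).mp (by rw [map_smul, h₀])
  have hs0 : s' ≠ 0 := by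
    rintro rfl
    exact h₁ (by rw [← hs', map_zero])
  obtain ⟨k, rfl⟩ := IsSimpleModule.toSpanSingleton_surjective Λ hs0 s
  exact ⟨k * l₀, by simp [mul_smul, hs']⟩

variable [IsArtinianRing Λ]

/-- Outside the radical, `x` would generate `Λe`, and `e` would kill `s` along with `x`. -/
lemma IsPrimitiveIdempotent.mem_jacobson_of_smul_eq_zero (hr : Ring.jacobson Λ ^ 2 = ⊥) {e x : Λ}
    (he : IsPrimitiveIdempotent e) {N : Type*} [AddCommGroup N] [Module Λ N] {s : N} (hs : s ≠ 0)
    (hes : e • s = s) (hxe : x * e = x) (hx : x • s = 0) : x ∈ Ring.jacobson Λ := by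
  by_contra h
  obtain ⟨c, hc⟩ := he.exists_mul_eq hr hxe h
  rw [← hc, mul_smul, hx, smul_zero] at hes
  exact hs hes.symm

/-- If the sequence `0 → S → P → S → 0` is almost split and `p ∈ eP` lifts a nonzero element of `S`,
then `Λe` acts faithfully on `p`. -/
lemma IsAlmostSplitSequence.eq_zero_of_smul_eq_zero (hr : Ring.jacobson Λ ^ 2 = ⊥) {g : S →ₗ[Λ] P}
    {h : P →ₗ[Λ] S} (H : IsAlmostSplitSequence g h) {e : Λ} (he : IsPrimitiveIdempotent e)
    {p : P} (hp : e • p = p) (hs : h p ≠ 0) {x : Λ} (hxe : x * e = x) (hx : x • p = 0) : x = 0 := by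
  have hes : e • h p = h p := by rw [← map_smul, hp]
  by_contra hx0
  have hxr : x ∈ Ring.jacobson Λ :=
    he.mem_jacobson_of_smul_eq_zero hr hs hes hxe (by rw [← map_smul, hx, map_zero])
  obtain ⟨C, hC, hxC, hcompl⟩ := exists_compl_span_singleton hr hxr hx0
  -- `Λ ⧸ L` is `Λe/(Λe ∩ C)`, a quotient in which `x` survives. The test map `m` sends the class of
  -- `1` to `h p`.
  let L : Ideal Λ := Submodule.comap (LinearMap.toSpanSingleton Λ Λ e) C
  have memL {l : Λ} : l ∈ L ↔ l * e ∈ C := Iff.rfl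
  let m : (Λ ⧸ L) →ₗ[Λ] S := L.liftQ (LinearMap.toSpanSingleton Λ S (h p)) fun l hl => by
    change l • h p = 0
    rw [← hes, ← mul_smul]
    exact smul_eq_zero_of_mem_jacobson (hC hl) _
  have hm (l : Λ) : m (Submodule.Quotient.mk l) = l • h p := rfl
  -- A section would embed `S`, which `r` kills, onto a submodule containing a generator of `Λ ⧸ L`;
  -- then `x` would vanish there.
  have hmns : ¬ IsSplitEpimorphism m := by
    rintro ⟨σ, hσ⟩
    obtain ⟨l, hl⟩ := Submodule.Quotient.mk_surjective _ (σ (h p))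
    have hls : l • h p = h p := by
      rw [← hm, hl]; exact LinearMap.congr_fun hσ (h p)
    have hu : l * e ∉ Ring.jacobson Λ := fun hu => hs <| by
      rw [← hls, ← hes, ← mul_smul]; exact smul_eq_zero_of_mem_jacobson hu _
    obtain ⟨c, hc⟩ := he.exists_mul_eq hr (by rw [mul_assoc, he.1.eq]) hu
    have hxc : x * c ∈ Ring.jacobson Λ := Ideal.mul_mem_right _ _ hxr
    have h0 : (x * c) • σ (h p) = 0 := by
      rw [← map_smul, smul_eq_zero_of_mem_jacobson hxc, map_zero]
    rw [← hl, ← Submodule.Quotient.mk_smul, Submodule.Quotient.mk_eq_zero, memL, smul_eq_mul,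
      mul_assoc, mul_assoc, hc, hxe] at h0
    exact hxC h0
  obtain ⟨t, ht⟩ := H.right_almost_split.2 _ m hmns
  obtain ⟨q, hq⟩ : ∃ q, q = t (Submodule.Quotient.mk 1) := ⟨_, rfl⟩
  have hLq {l : Λ} (hl : l * e ∈ C) : l • q = 0 := by
    rw [hq, ← map_smul, ← Submodule.Quotient.mk_smul, smul_eq_mul, mul_one,
      (Submodule.Quotient.mk_eq_zero L).mpr hl, map_zero]
  have hhq : h q = h p := by
    rw [hq, ← LinearMap.comp_apply, ← ht, hm, one_smul]
  have heq : e • q = q := by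
    have := hLq (l := 1 - e) (by rw [sub_mul, one_mul, he.1.eq, sub_self]; exact C.zero_mem)
    rw [sub_smul, one_smul] at this
    exact (sub_eq_zero.mp this).symm
  -- `q` is a second lift of `h p`, so `p - q` lies in the image of `S`, which `r` kills. With `r =
  -- Λx + C`, all of `re` kills `q`, and `h p ↦ q` splits `h`.
  have hxq : x • q = 0 := by
    obtain ⟨s', hs'⟩ := (H.exact (p - q)).mp (by rw [map_sub, hhq, sub_self])
    have : x • (p - q) = 0 := by
      rw [← hs', ← map_smul, smul_eq_zero_of_mem_jacobson hxr, map_zero]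
    rw [smul_sub, hx, zero_sub, neg_eq_zero] at this
    exact this
  have hrq {y : Λ} (hy : y ∈ Ring.jacobson Λ) (hye : y * e = y) : y • q = 0 := by
    obtain ⟨l, hl⟩ := hcompl y hy
    have := hLq (l := y - l * x) (by rwa [sub_mul, hye, mul_assoc, hxe])
    rwa [sub_smul, mul_smul, hxq, smul_zero, sub_zero] at this
  obtain ⟨f, hf⟩ := exists_linearMap_of_annihilates hs q fun l hl => by
    rw [← heq, ← mul_smul]
    have hle : l * e * e = l * e := by rw [mul_assoc, he.1.eq]
    exact hrq (he.mem_jacobson_of_smul_eq_zero hr hs hes hle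
      (by rw [mul_smul, hes, hl])) hle
  exact H.right_almost_split.1 (isSplitEpimorphism_of_map_eq hs f (by rw [hf, hhq]))

/-- If `0 → S → P → S → 0` is almost split and `y • p` spans the image of `S` in `P`, then every
`x ∈ eΛ` in the radical is a right multiple of `y`. -/
lemma IsAlmostSplitSequence.exists_eq_mul (hr : Ring.jacobson Λ ^ 2 = ⊥) {g : S →ₗ[Λ] P}
    {h : P →ₗ[Λ] S} (H : IsAlmostSplitSequence g h) {e : Λ} (he : IsPrimitiveIdempotent e)
    {p : P} {s : S} (hs : s ≠ 0) (hes : e • s = s) {y : Λ} (hy : y • p = g s) {x : Λ}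
    (hex : e * x = x) (hx : x ∈ Ring.jacobson Λ) : ∃ z, x = y * z := by
  obtain ⟨m, hm⟩ := exists_linearMap_of_annihilates hs x fun l hl => by
    have : l * e ∈ Ring.jacobson Λ := he.mem_jacobson_of_smul_eq_zero hr hs hes
      (by rw [mul_assoc, he.1.eq]) (by rw [mul_smul, hes, hl])
    rw [smul_eq_mul, ← hex, ← mul_assoc]
    exact mul_eq_zero_of_jacobson_sq hr this hx
  have hmns : ¬ IsSplitMonomorphism m := by
    rintro ⟨t, ht⟩
    have h1 : t (m s) = s := LinearMap.congr_fun ht s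
    rw [hm, ← mul_one x, ← smul_eq_mul, map_smul, smul_eq_zero_of_mem_jacobson hx] at h1
    exact hs h1.symm
  obtain ⟨t, ht⟩ := H.left_almost_split.2 _ m hmns
  refine ⟨t p, ?_⟩
  rw [← hm, ht, LinearMap.comp_apply, ← hy, map_smul, smul_eq_mul]

theorem IsAlmostSplitSequence.injective_and_isLocalRing (hr : Ring.jacobson Λ ^ 2 = ⊥)
    (hbasic : IsBasicRing Λ) (hconn : IsConnectedRing Λ) {g : S →ₗ[Λ] P} {h : P →ₗ[Λ] S}
    (H : IsAlmostSplitSequence g h) : Module.Injective Λ Λ ∧ IsLocalRing Λ := by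
  obtain ⟨n, E, hE, hprim, hiso⟩ := hbasic
  have := hconn.1
  have := IsSimpleModule.nontrivial Λ S
  obtain ⟨i, s, hs, hes⟩ : ∃ i, ∃ s : S, s ≠ 0 ∧ E i • s = s := by
    obtain ⟨s, hs⟩ := exists_ne (0 : S)
    by_contra! hcon
    apply hs
    rw [← one_smul Λ s, ← hE.complete, Finset.sum_smul]
    refine Finset.sum_eq_zero fun i _ => ?_
    by_contra hi
    exact hcon i _ hi (by rw [← mul_smul, (hprim i).1.eq])
  obtain ⟨p', hp'⟩ := H.surjective s
  obtain ⟨p, hp, hhp⟩ : ∃ p, E i • p = p ∧ h p = s :=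
    ⟨E i • p', by rw [← mul_smul, (hprim i).1.eq], by rw [map_smul, hp', hes]⟩
  have hhp0 : h p ≠ 0 := by rwa [hhp]
  obtain ⟨y, hyE, hy⟩ : ∃ y, y * E i = y ∧ y • p = g s := by
    obtain ⟨l, hl⟩ := H.exists_smul_eq hhp0 s
    exact ⟨l * E i, by rw [mul_assoc, (hprim i).1.eq], by rw [mul_smul, hp, hl]⟩
  have hyr : y ∈ Ring.jacobson Λ := (hprim i).mem_jacobson_of_smul_eq_zero hr hs hes hyE <| by
    rw [← hhp, ← map_smul, hy]; exact H.exact.apply_apply_eq_zero s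
  have hfaith {x : Λ} (hxe : x * E i = x) (hx : x • p = 0) : x = 0 :=
    H.eq_zero_of_smul_eq_zero hr (hprim i) hp hhp0 hxe hx
  have hS (j : Fin n) (hj : j ≠ i) (s' : S) : E j • s' = 0 := by
    by_contra h0
    obtain ⟨φ⟩ := nonempty_span_equiv_of_smul_ne_zero hr (hprim j) (hprim i) h0
      (s' := s) (by rwa [hes])
    exact (hiso j i hj).false φ
  -- `E j` kills `S`, hence both the image and the cokernel of `g`, while `ΛE i` embeds in `P`.
  have hleft (j : Fin n) (hj : j ≠ i) (l : Λ) : E j * l * E i = 0 := by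
    apply hfaith (by rw [mul_assoc, (hprim i).1.eq])
    rw [mul_smul, hp]
    obtain ⟨s', hs'⟩ := (H.exact ((E j * l) • p)).mp (by rw [map_smul, mul_smul, hS j hj])
    rw [← (hprim j).1.eq, mul_assoc, mul_smul, ← hs', ← map_smul, hS j hj, map_zero]
  have hright (j : Fin n) (hj : j ≠ i) (l : Λ) : E i * l * E j = 0 := by
    obtain ⟨x, hx⟩ : ∃ x, x = E i * l * E j := ⟨_, rfl⟩
    have hix : E i * x = x := by rw [hx, ← mul_assoc, ← mul_assoc, (hprim i).1.eq]
    have hxj : x * E j = x := by rw [hx, mul_assoc, (hprim j).1.eq]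
    have mem {z : Λ} (h1 : E i * z = z) (h2 : z * E j = z) : z ∈ Ring.jacobson Λ := by
      by_contra hz
      obtain ⟨φ⟩ := nonempty_span_equiv_of_notMem hr (hprim i) (hprim j) h1 h2 hz
      exact (hiso i j hj.symm).false φ
    obtain ⟨z, hz⟩ := H.exists_eq_mul hr (hprim i) hs hes hy hix (mem hix hxj)
    -- Both factors are radical: the second lies between non-isomorphic projectives. Hence `x ∈ r² =
    -- 0`.
    have hx' : x = y * (E i * z * E j) := by
      rw [← mul_assoc, ← mul_assoc, hyE, ← hz, hxj]
    rw [← hx, hx']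
    exact mul_eq_zero_of_jacobson_sq hr hyr (mem
      (by rw [← mul_assoc, ← mul_assoc, (hprim i).1.eq]) (by rw [mul_assoc, (hprim j).1.eq]))
  have hcenter : E i ∈ Subring.center Λ := by
    refine Subring.mem_center_iff.mpr fun l => ?_
    have h1 : l * E i = E i * l * E i := by
      calc l * E i = (∑ j, E j) * (l * E i) := by rw [hE.complete, one_mul]
        _ = ∑ j, E j * l * E i := by simp_rw [Finset.sum_mul, mul_assoc]
        _ = _ := Finset.sum_eq_single i (fun j _ hj => hleft j hj l) (by simp)
    have h2 : E i * l = E i * l * E i := by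
      calc E i * l = (E i * l) * (∑ j, E j) := by rw [hE.complete, mul_one]
        _ = ∑ j, E i * l * E j := by simp_rw [Finset.mul_sum]
        _ = _ := Finset.sum_eq_single i (fun j _ hj => hright j hj l) (by simp)
    rw [h1, ← h2]
  have hone : IsPrimitiveIdempotent (1 : Λ) :=
    (hconn.2 _ hcenter (hprim i).1).resolve_left (hprim i).2.1 ▸ hprim i
  have hi1 : E i = 1 := (hconn.2 _ hcenter (hprim i).1).resolve_left (hprim i).2.1
  have hinv {x : Λ} (hx : x ∉ Ring.jacobson Λ) : ∃ c, c * x = 1 :=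
    hone.exists_mul_eq hr (mul_one x) hx
  constructor
  · refine Module.Baer.injective fun I φ => ?_
    by_cases hI : I ≤ Ring.jacobson Λ
    · by_cases hI0 : I = ⊥
      · subst hI0
        refine ⟨0, fun x hx => ?_⟩
        have : (⟨x, hx⟩ : (⊥ : Ideal Λ)) = 0 := Subsingleton.elim _ _
        rw [this]; simp
      · have hgen {x : Λ} (hx : x ∈ Ring.jacobson Λ) : ∃ l, x = l * y := by
          obtain ⟨s', hs'⟩ := (H.exact (x • p)).mp
            (by rw [map_smul, smul_eq_zero_of_mem_jacobson hx])
          obtain ⟨l, rfl⟩ := IsSimpleModule.toSpanSingleton_surjective Λ hs s'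
          refine ⟨l, sub_eq_zero.mp (hfaith (by rw [hi1, mul_one]) ?_)⟩
          rw [sub_smul, mul_smul, hy, ← hs', LinearMap.toSpanSingleton_apply, map_smul, sub_self]
        obtain ⟨x, hxI, hx0⟩ := Submodule.exists_mem_ne_zero_of_ne_bot hI0
        have hyI : y ∈ I := by
          obtain ⟨l, rfl⟩ := hgen (hI hxI)
          obtain ⟨c, hc⟩ := hinv fun hl => hx0 (mul_eq_zero_of_jacobson_sq hr hl hyr)
          rw [← one_mul y, ← hc, mul_assoc]
          exact I.mul_mem_left _ hxI
        -- `r` kills `y`, hence `φ y`, which therefore cannot be left invertible as `r ≠ 0`.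
        have hw : φ ⟨y, hyI⟩ ∈ Ring.jacobson Λ := by
          by_contra hw
          obtain ⟨c, hc⟩ := hinv hw
          apply hx0
          have hxc : x * c ∈ Ring.jacobson Λ := Ideal.mul_mem_right _ _ (hI hxI)
          have : (x * c) • (⟨y, hyI⟩ : I) = 0 :=
            Subtype.ext (mul_eq_zero_of_jacobson_sq hr hxc hyr)
          have h0 := congrArg φ this
          rwa [map_smul, map_zero, smul_eq_mul, mul_assoc, hc, mul_one] at h0
        obtain ⟨z, hz⟩ := H.exists_eq_mul hr (hprim i) hs hes hy (by rw [hi1, one_mul]) hw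
        refine ⟨LinearMap.toSpanSingleton Λ Λ z, fun x' hx' => ?_⟩
        obtain ⟨l, rfl⟩ := hgen (hI hx')
        have : (⟨l * y, hx'⟩ : I) = l • ⟨y, hyI⟩ := rfl
        rw [this, map_smul, hz, LinearMap.toSpanSingleton_apply, smul_eq_mul, smul_eq_mul,
          mul_assoc]
    · obtain ⟨x, hxI, hx⟩ := SetLike.not_le_iff_exists.mp hI
      obtain ⟨c, hc⟩ := hinv hx
      have h1 : (1 : Λ) ∈ I := hc ▸ I.mul_mem_left c hxI
      refine ⟨LinearMap.toSpanSingleton Λ Λ (φ ⟨1, h1⟩), fun x' hx' => ?_⟩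
      rw [LinearMap.toSpanSingleton_apply, ← map_smul]
      congr 1
      exact Subtype.ext (mul_one x')
  · refine IsLocalRing.of_isUnit_or_isUnit_of_isUnit_add fun a b hab => ?_
    have hunit {x : Λ} (hx : x ∉ Ring.jacobson Λ) : IsUnit x := by
      obtain ⟨c, hc⟩ := hinv hx
      exact IsUnit.of_mul_eq_one_right c hc
    by_contra! hcon
    have ha := not_imp_comm.mp hunit hcon.1
    have hb := not_imp_comm.mp hunit hcon.2
    obtain ⟨u, hu⟩ := hab
    refine Ring.jacobson_lt_top Λ |>.ne ?_
    exact Ideal.eq_top_of_isUnit_mem _ (hu ▸ add_mem ha hb) u.isUnit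

end AlmostSplit

/-! ### From a self-injective local ring to an almost split sequence. -/

section SelfInjectiveLocal

/-- Equal kernels make the ranges isomorphic, and an Artinian module is not isomorphic to a proper
submodule. This serves to turn `Λa ⊆ aΛ` into equality. -/
lemma LinearMap.range_eq_of_ker_eq_of_le {R M N : Type*} [Ring R] [AddCommGroup M] [Module R M]
    [AddCommGroup N] [Module R N] [IsArtinian R N] {f g : M →ₗ[R] N}
    (hker : LinearMap.ker f = LinearMap.ker g) (hle : LinearMap.range f ≤ LinearMap.range g) :
    LinearMap.range f = LinearMap.range g := by
  let φ : LinearMap.range g ≃ₗ[R] LinearMap.range f :=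
    g.quotKerEquivRange.symm ≪≫ₗ Submodule.quotEquivOfEq _ _ hker.symm ≪≫ₗ f.quotKerEquivRange
  refine le_antisymm hle fun x hx => ?_
  obtain ⟨y, hy⟩ := IsArtinian.surjective_of_injective_endomorphism
    (Submodule.inclusion hle ∘ₗ φ.toLinearMap)
    ((Submodule.inclusion_injective hle).comp φ.injective) ⟨x, hx⟩
  have : (φ y : N) = x := congrArg Subtype.val hy
  rw [← this]
  exact (φ y).2

variable {Λ : Type u} [Ring Λ]

lemma IsLocalRing.isUnit_of_notMem_jacobson [IsLocalRing Λ] [IsArtinianRing Λ]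
    (hr : Ring.jacobson Λ ^ 2 = ⊥) {x : Λ} (hx : x ∉ Ring.jacobson Λ) : IsUnit x := by
  obtain ⟨c, hc, hc0⟩ := exists_isIdempotentElem_mul hr hx
  rcases IsLocalRing.isUnit_or_isUnit_of_isUnit_add (a := c * x) (b := 1 - c * x)
    (by rw [add_sub_cancel]; exact isUnit_one) with h | h
  · have : c * x = 1 := h.mul_left_cancel (by rw [hc.eq, mul_one])
    exact IsUnit.of_mul_eq_one_right c this
  · refine (hc0 (h.mul_left_cancel ?_)).elim
    rw [sub_mul, one_mul, hc.eq, sub_self, mul_zero]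

/-- If every element outside the radical is a unit, a nonzero element `a` of the radical has
`r` as its left and right annihilator. -/
lemma mul_eq_zero_iff_mem_jacobson (hr : Ring.jacobson Λ ^ 2 = ⊥)
    (hunit : ∀ x : Λ, x ∉ Ring.jacobson Λ → IsUnit x) {a : Λ}
    (ha : a ∈ Ring.jacobson Λ) (ha0 : a ≠ 0)
    (l : Λ) : (l * a = 0 ↔ l ∈ Ring.jacobson Λ) ∧ (a * l = 0 ↔ l ∈ Ring.jacobson Λ) := by
  refine ⟨⟨fun h => ?_, fun h => mul_eq_zero_of_jacobson_sq hr h ha⟩,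
    ⟨fun h => ?_, fun h => mul_eq_zero_of_jacobson_sq hr ha h⟩⟩
  · by_contra hl
    exact ha0 ((hunit l hl).mul_left_cancel (by rw [h, mul_zero]))
  · by_contra hl
    exact ha0 ((hunit l hl).mul_right_cancel (by rw [h, zero_mul]))

/-- In a self-injective local ring with square-zero radical, the radical is generated as a right
ideal by each of its nonzero elements. -/
lemma exists_eq_mul_of_injective [Module.Injective Λ Λ] (hr : Ring.jacobson Λ ^ 2 = ⊥)
    (hunit : ∀ x : Λ, x ∉ Ring.jacobson Λ → IsUnit x) {a b : Λ}
    (ha : a ∈ Ring.jacobson Λ) (ha0 : a ≠ 0)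
    (hb : b ∈ Ring.jacobson Λ) : ∃ c, b = a * c := by
  let f (d : Λ) (hd : d ∈ Ring.jacobson Λ) : (Λ ⧸ Ring.jacobson Λ) →ₗ[Λ] Λ :=
    (Ring.jacobson Λ).liftQ (LinearMap.toSpanSingleton Λ Λ d) fun l hl =>
      mul_eq_zero_of_jacobson_sq hr hl hd
  have hf {d : Λ} (hd : d ∈ Ring.jacobson Λ) (l : Λ) :
      f d hd (Submodule.Quotient.mk l) = l * d := rfl
  have hinj : Function.Injective (f a ha) := by
    refine (injective_iff_map_eq_zero _).mpr fun x hx => ?_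
    obtain ⟨l, rfl⟩ := Submodule.Quotient.mk_surjective _ x
    exact (Submodule.Quotient.mk_eq_zero _).mpr
      ((mul_eq_zero_iff_mem_jacobson hr hunit ha ha0 l).1.mp hx)
  -- The extension satisfies `b = h a = a * h 1`, so `c = h 1`.
  obtain ⟨h, hh⟩ := Module.Injective.out (f a ha) hinj (f b hb)
  have := hh (Submodule.Quotient.mk 1)
  rw [hf ha, hf hb, one_mul, one_mul, ← mul_one a, ← smul_eq_mul, map_smul, smul_eq_mul] at this
  exact ⟨_, this.symm⟩

/-- In a self-injective local Artin algebra with square-zero radical, the radical is generated as a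
left ideal by each of its nonzero elements. -/
lemma exists_eq_mul_of_injective' (R : Type*) [CommRing R] [Algebra R Λ] [IsArtinian R Λ]
    [Module.Injective Λ Λ] (hr : Ring.jacobson Λ ^ 2 = ⊥)
    (hunit : ∀ x : Λ, x ∉ Ring.jacobson Λ → IsUnit x) {a b : Λ}
    (ha : a ∈ Ring.jacobson Λ) (ha0 : a ≠ 0)
    (hb : b ∈ Ring.jacobson Λ) : ∃ c, b = c * a := by
  have hiff := mul_eq_zero_iff_mem_jacobson hr hunit ha ha0
  -- The two multiplications by `a` are linear only over `R`; both have kernel `r`.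
  have hrange := LinearMap.range_eq_of_ker_eq_of_le
    (f := LinearMap.mulRight R a) (g := LinearMap.mulLeft R a)
    (by ext l; exact (hiff l).1.trans (hiff l).2.symm) (by
      rintro _ ⟨l, rfl⟩
      obtain ⟨c, hc⟩ := exists_eq_mul_of_injective hr hunit ha ha0
        ((Ring.jacobson Λ).mul_mem_left l ha)
      exact ⟨c, hc.symm⟩)
  obtain ⟨c, hc⟩ := exists_eq_mul_of_injective hr hunit ha ha0 hb
  have : b ∈ LinearMap.range (LinearMap.mulRight R a) := by
    rw [hrange]; exact ⟨c, hc.symm⟩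
  obtain ⟨d, hd⟩ := this
  exact ⟨d, hd.symm⟩

/-- The submodule `aN` of `N` when `a * Λ` is a left ideal. -/
def smulRangeSubmodule {a : Λ} (h : ∀ l : Λ, ∃ c, l * a = a * c) (N : Type*) [AddCommGroup N]
    [Module Λ N] : Submodule Λ N where
  carrier := {w | ∃ n : N, a • n = w}
  add_mem' := by
    rintro _ _ ⟨n, rfl⟩ ⟨n', rfl⟩
    exact ⟨n + n', smul_add _ _ _⟩
  zero_mem' := ⟨0, smul_zero _⟩
  smul_mem' := by
    rintro l _ ⟨n, rfl⟩
    obtain ⟨c, hc⟩ := h l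
    exact ⟨c • n, by rw [← mul_smul, ← hc, mul_smul]⟩

/-- Extension of `a • n ↦ a * m n` from `aN` to `N`, showing that `m` lifts along `Λ → Λ/r`. -/
lemma exists_lift_of_injective [Module.Injective Λ Λ] (hr : Ring.jacobson Λ ^ 2 = ⊥)
    (hunit : ∀ x : Λ, x ∉ Ring.jacobson Λ → IsUnit x) {a : Λ}
    (ha : a ∈ Ring.jacobson Λ) (ha0 : a ≠ 0)
    (hswap : ∀ l : Λ, ∃ c, l * a = a * c) {N : Type u} [AddCommGroup N] [Module Λ N]
    (m : N →ₗ[Λ] Λ ⧸ Ring.jacobson Λ) (hm : ∀ n, a • n = 0 → m n = 0) :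
    ∃ t : N →ₗ[Λ] Λ, m = (Ring.jacobson Λ).mkQ ∘ₗ t := by
  have hiff := mul_eq_zero_iff_mem_jacobson hr hunit ha ha0
  let W := smulRangeSubmodule hswap N
  have hex (w : W) : ∃ (n : N) (l : Λ), a • n = w ∧ Submodule.Quotient.mk l = m n := by
    obtain ⟨n, hn⟩ := w.2
    obtain ⟨l, hl⟩ := Submodule.Quotient.mk_surjective _ (m n)
    exact ⟨n, l, hn, hl⟩
  choose n l hn hl using hex
  -- Independence of choices: `m` kills the annihilator of `a` in `N`, and `a * r = 0`.
  have key (w : W) (n' : N) (l' : Λ) (h1 : a • n' = w) (h2 : Submodule.Quotient.mk l' = m n') :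
      a * l w = a * l' := by
    have h3 := hm (n w - n') (by rw [smul_sub, hn, h1, sub_self])
    rw [map_sub, ← hl, ← h2, ← Submodule.Quotient.mk_sub, Submodule.Quotient.mk_eq_zero] at h3
    exact sub_eq_zero.mp (by rw [← mul_sub]; exact (hiff _).2.mpr h3)
  let φ : W →ₗ[Λ] Λ :=
    { toFun := fun w => a * l w
      map_add' := fun w w' => by
        rw [← mul_add]
        exact key _ (n w + n w') _ (by rw [smul_add, hn, hn]; rfl)
          (by rw [Submodule.Quotient.mk_add, hl, hl, map_add])
      map_smul' := fun k w => by
        obtain ⟨c, hc⟩ := hswap k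
        have : a * l (k • w) = a * (c * l w) := key _ (c • n w) _
          (by rw [← mul_smul, ← hc, mul_smul, hn]; rfl)
          (by rw [← smul_eq_mul, Submodule.Quotient.mk_smul, hl, map_smul])
        rw [this, ← mul_assoc, ← hc, mul_assoc]; rfl }
  obtain ⟨t, ht⟩ := Module.Injective.out W.subtype W.injective_subtype φ
  refine ⟨t, LinearMap.ext fun x => ?_⟩
  obtain ⟨k, hk⟩ := Submodule.Quotient.mk_surjective _ (m x)
  have h1 : a * t x = a * k := by
    have h2 := ht ⟨a • x, x, rfl⟩
    rw [Submodule.subtype_apply, map_smul, smul_eq_mul] at h2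
    exact h2.trans (key _ x k rfl hk)
  rw [← hk, LinearMap.comp_apply, Submodule.mkQ_apply, eq_comm, Submodule.Quotient.eq,
    ← (hiff _).2, mul_sub, h1, sub_self]

/-- A map out of the simple module `Λ/r` that is not a split monomorphism has image in `rN`. -/
lemma exists_smul_eq_of_not_isSplitMonomorphism [IsArtinianRing Λ]
    [IsSimpleModule Λ (Λ ⧸ Ring.jacobson Λ)] {a : Λ}
    (hleft : ∀ b ∈ Ring.jacobson Λ, ∃ c, b = a * c) (hswap : ∀ l : Λ, ∃ c, l * a = a * c)
    {N : Type*} [AddCommGroup N] [Module Λ N] (m : (Λ ⧸ Ring.jacobson Λ) →ₗ[Λ] N)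
    (hm : ¬ IsSplitMonomorphism m) : ∃ x : N, a • x = m (Submodule.Quotient.mk 1) := by
  let W := smulRangeSubmodule hswap N
  -- `N/aN` is killed by `r = aΛ`, so it is semisimple; a nonzero map `Λ/r → N/aN` is injective and
  -- splits, which would split `m`.
  by_contra hcon
  have : IsSemisimpleModule Λ (N ⧸ W) := by
    refine isSemisimpleModule_of_jacobson_smul_eq_zero fun b hb x => ?_
    obtain ⟨x, rfl⟩ := Submodule.Quotient.mk_surjective _ x
    obtain ⟨c, rfl⟩ := hleft b hb
    rw [← Submodule.Quotient.mk_smul, Submodule.Quotient.mk_eq_zero, mul_smul]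
    exact ⟨_, rfl⟩
  rcases (W.mkQ ∘ₗ m).injective_or_eq_zero with h | h
  · obtain ⟨t, ht⟩ := IsSemisimpleModule.extension_property _ h LinearMap.id
    exact hm ⟨t ∘ₗ W.mkQ, ht⟩
  · exact hcon ((Submodule.Quotient.mk_eq_zero W).mp
      (LinearMap.congr_fun h (Submodule.Quotient.mk 1)))

theorem exists_isAlmostSplitSequence (R : Type*) [CommRing R] [IsArtinianRing R] [Algebra R Λ]
    [Module.Finite R Λ] [Module.Injective Λ Λ] [IsLocalRing Λ] (hnss : ¬ IsSemisimpleRing Λ)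
    (hr : Ring.jacobson Λ ^ 2 = ⊥) :
    ∃ (S P : Type u) (_ : AddCommGroup S) (_ : Module Λ S) (_ : AddCommGroup P) (_ : Module Λ P)
      (g : S →ₗ[Λ] P) (h : P →ₗ[Λ] S),
      IsSimpleModule Λ S ∧ Module.Projective Λ P ∧ IsAlmostSplitSequence g h := by
  have : IsArtinian R Λ := inferInstance
  have : IsArtinianRing Λ := isArtinian_of_tower R this
  have hunit (x : Λ) (hx : x ∉ Ring.jacobson Λ) : IsUnit x :=
    IsLocalRing.isUnit_of_notMem_jacobson hr hx
  obtain ⟨a, ha, ha0⟩ := Submodule.exists_mem_ne_zero_of_ne_bot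
    (mt IsArtinianRing.isSemisimpleRing_iff_jacobson.mpr hnss)
  have hiff := mul_eq_zero_iff_mem_jacobson hr hunit ha ha0
  have hleft (b : Λ) (hb : b ∈ Ring.jacobson Λ) : ∃ c, b = c * a :=
    exists_eq_mul_of_injective' R hr hunit ha ha0 hb
  have hright (b : Λ) (hb : b ∈ Ring.jacobson Λ) : ∃ c, b = a * c :=
    exists_eq_mul_of_injective hr hunit ha ha0 hb
  have hswap (l : Λ) : ∃ c, l * a = a * c := hright _ ((Ring.jacobson Λ).mul_mem_left l ha)
  have hsimple : IsSimpleModule Λ (Λ ⧸ Ring.jacobson Λ) := by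
    refine isSimpleModule_iff_isCoatom.mpr ⟨(Ring.jacobson_lt_top Λ).ne, fun I hI => ?_⟩
    obtain ⟨x, hxI, hx⟩ := SetLike.exists_of_lt hI
    exact Ideal.eq_top_of_isUnit_mem _ hxI (hunit x hx)
  have hmk1 : (Submodule.Quotient.mk 1 : Λ ⧸ Ring.jacobson Λ) ≠ 0 := fun h =>
    (Ring.jacobson_lt_top Λ).ne <|
      (Ideal.eq_top_iff_one _).mpr ((Submodule.Quotient.mk_eq_zero _).mp h)
  let g : (Λ ⧸ Ring.jacobson Λ) →ₗ[Λ] Λ :=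
    (Ring.jacobson Λ).liftQ (LinearMap.toSpanSingleton Λ Λ a) fun l hl => (hiff l).1.mpr hl
  have hg (l : Λ) : g (Submodule.Quotient.mk l) = l * a := rfl
  refine ⟨Λ ⧸ Ring.jacobson Λ, Λ, _, _, _, _, g, (Ring.jacobson Λ).mkQ, hsimple, inferInstance,
    inferInstance, inferInstance, inferInstance, ?_, ?_, Submodule.mkQ_surjective _,
    ⟨?_, ?_⟩, ⟨?_, ?_⟩⟩
  · refine (injective_iff_map_eq_zero g).mpr fun x hx => ?_
    obtain ⟨l, rfl⟩ := Submodule.Quotient.mk_surjective _ x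
    exact (Submodule.Quotient.mk_eq_zero _).mpr ((hiff l).1.mp hx)
  · intro b
    rw [Submodule.mkQ_apply, Submodule.Quotient.mk_eq_zero]
    refine ⟨fun hb => ?_, ?_⟩
    · obtain ⟨c, rfl⟩ := hleft b hb
      exact ⟨Submodule.Quotient.mk c, hg c⟩
    · rintro ⟨x, rfl⟩
      obtain ⟨l, rfl⟩ := Submodule.Quotient.mk_surjective _ x
      exact (Ring.jacobson Λ).mul_mem_left l ha
  · rintro ⟨t, ht⟩
    have h1 : t (g (Submodule.Quotient.mk 1)) = Submodule.Quotient.mk 1 :=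
      LinearMap.congr_fun ht _
    rw [hg, one_mul, ← mul_one a, ← smul_eq_mul, map_smul, smul_eq_zero_of_mem_jacobson ha] at h1
    exact hmk1 h1.symm
  · intro N _ _ _ m hm
    obtain ⟨x, hx⟩ := exists_smul_eq_of_not_isSplitMonomorphism hright hswap m hm
    -- With `m 1 = a • x`, the map `l ↦ l • x` sends `g l = l * a` to `l • m 1`.
    refine ⟨LinearMap.toSpanSingleton Λ N x, LinearMap.ext fun y => ?_⟩
    obtain ⟨l, rfl⟩ := Submodule.Quotient.mk_surjective _ y
    rw [LinearMap.comp_apply, hg, LinearMap.toSpanSingleton_apply, mul_smul, hx, ← map_smul,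
      ← Submodule.Quotient.mk_smul, smul_eq_mul, mul_one]
  · rintro ⟨σ, hσ⟩
    have h1 : a * σ (Submodule.Quotient.mk 1) = 0 := by
      rw [← smul_eq_mul, ← map_smul, smul_eq_zero_of_mem_jacobson ha, map_zero]
    exact hmk1 ((LinearMap.congr_fun hσ (Submodule.Quotient.mk 1)).symm.trans
      ((Submodule.Quotient.mk_eq_zero _).mpr ((hiff _).2.mp h1)))
  · intro N _ _ _ m hm
    refine exists_lift_of_injective hr hunit ha ha0 hswap m fun n hn => ?_
    by_contra hmn
    -- If `a` kills `n`, so does `r = Λa`, and `m n ↦ n` is a section of `m`.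
    obtain ⟨f, hf⟩ := exists_linearMap_of_annihilates hmn n fun l hl => by
      have hlr : l ∈ Ring.jacobson Λ := by
        by_contra hlr
        obtain ⟨c, hc⟩ := (hunit l hlr).exists_left_inv
        exact hmn (by rw [← one_smul Λ (m n), ← hc, mul_smul, hl, smul_zero])
      obtain ⟨c, rfl⟩ := hleft l hlr
      rw [mul_smul, hn, smul_zero]
    exact hm (isSplitEpimorphism_of_map_eq hmn f (by rw [hf]))

end SelfInjectiveLocal

theorem proposition3p2 {R : Type v} [CommRing R] [IsArtinianRing R]
    {Λ : Type u} [Ring Λ] [Algebra R Λ] [Module.Finite R Λ]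
    (hbasic : IsBasicRing Λ) (hconn : IsConnectedRing Λ) (hnss : ¬ IsSemisimpleRing Λ)
    (hrad : Ring.jacobson Λ ^ 2 = ⊥) :
    List.TFAE [
      Module.Injective Λ Λ ∧ IsLocalRing Λ,
      ∃ (S P : Type u) (_ : AddCommGroup S) (_ : Module Λ S) (_ : AddCommGroup P) (_ : Module Λ P)
        (g : S →ₗ[Λ] P) (h : P →ₗ[Λ] S),
        IsSimpleModule Λ S ∧ IsAlmostSplitSequence g h,
      ∃ (S P : Type u) (_ : AddCommGroup S) (_ : Module Λ S) (_ : AddCommGroup P) (_ : Module Λ P)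
        (g : S →ₗ[Λ] P) (h : P →ₗ[Λ] S),
        IsSimpleModule Λ S ∧ Module.Projective Λ P ∧ IsAlmostSplitSequence g h] := by
  have : IsArtinianRing Λ := isArtinian_of_tower R (inferInstanceAs (IsArtinian R Λ))
  tfae_have 1 → 3 := fun ⟨_, _⟩ => exists_isAlmostSplitSequence R hnss hrad
  tfae_have 3 → 2 := fun ⟨S, P, i₁, i₂, i₃, i₄, g, h, hS, _, H⟩ =>
    ⟨S, P, i₁, i₂, i₃, i₄, g, h, hS, H⟩
  tfae_have 2 → 1 := fun ⟨_, _, _, _, _, _, _, _, _, H⟩ =>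
    H.injective_and_isLocalRing hrad hbasic hconn
  tfae_finish
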